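/- Let $\mu$ be a finite positive Borel measure on the unit circle $\partial\mathbb{D}=\{z\in\mathbb{C} : |z|=1\}$, with Lebesgue decomposition $$d\mu(e^{i\theta}) = w(\theta)\,\frac{d\theta}{2\pi} + d\mu_{\mathrm{s}}(e^{i\theta}),$$ where $\mu_{\mathrm{s}}$ is singular with respect to Lebesgue measure on $\partial\mathbb{D}$. Suppose that $w(\theta)>0$ for Lebesgue-a.e. $\theta$. Let $\Phi_n$ ($n\ge 0$) be the monic orthogonal polynomials of $\mu$, obtained by applying the Gram–Schmidt process (without normalization) to $1,z,z^2,\dots$ in $L^2(\partial\mathbb{D},d\mu)$, and let $\varphi_n=\Phi_n/\|\Phi_n\|_{L^2(\partial\mathbb{D},d\mu)}$ be the orthonormal polynomials. Then $$\lim_{n\to\infty}\ \frac{1}{n+1}\int \sum_{j=0}^{n} |\varphi_j(e^{i\theta})|^2\, d\mu_{\mathrm{s}}(\theta) = 0.$$ -/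

import Mathlib

open MeasureTheory Filter Topology Polynomial

noncomputable section

namespace OPUC

/-- The unit circle carries its Borel sigma-algebra. -/
instance instMeasurableSpaceCircle : MeasurableSpace Circle := borel Circle

instance instBorelSpaceCircle : BorelSpace Circle := ⟨rfl⟩

/-- Normalized Lebesgue measure `dθ / 2π` on the unit circle: the image of Lebesgue measure on
`(-π, π]`, divided by `2π`, under `θ ↦ exp (i θ)`. -/
def circleLebesgue : Measure Circle :=
  (ENNReal.ofReal (2 * Real.pi))⁻¹ •
    (volume.restrict (Set.Ioc (-Real.pi) Real.pi)).map (fun θ : ℝ => Circle.exp θ)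

/-- The inner product `⟨p, q⟩ = ∫ conj (p z) * q z dμ(z)` of polynomials in `L²(∂𝔻, μ)`,
conjugate-linear in the first argument. -/
def polyInner (μ : Measure Circle) (p q : ℂ[X]) : ℂ :=
  ∫ z : Circle, (starRingEnd ℂ) (p.eval (z : ℂ)) * q.eval (z : ℂ) ∂μ

/-- The `L²(∂𝔻, μ)` norm of a polynomial. -/
def polyNorm (μ : Measure Circle) (p : ℂ[X]) : ℝ :=
  Real.sqrt (∫ z : Circle, ‖p.eval (z : ℂ)‖ ^ 2 ∂μ)

/-- The monic orthogonal polynomials `Φ_n(z, dμ)`: the Gram-Schmidt process applied to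
`1, z, z², …` in `L²(∂𝔻, μ)`. -/
def monicOPUC (μ : Measure Circle) (n : ℕ) : ℂ[X] :=
  X ^ n - ∑ j : Fin n,
    C (polyInner μ (monicOPUC μ j) (X ^ n) / polyInner μ (monicOPUC μ j) (monicOPUC μ j)) *
      monicOPUC μ j
termination_by n
decreasing_by exact j.isLt

/-- The orthonormal polynomials `φ_n(z, dμ) = Φ_n / ‖Φ_n‖`. -/
def orthonormalOPUC (μ : Measure Circle) (n : ℕ) : ℂ[X] :=
  C (((polyNorm μ (monicOPUC μ n))⁻¹ : ℝ) : ℂ) * monicOPUC μ n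

end OPUC

end

/-!
Write `K_n` for the diagonal Christoffel–Darboux kernel, `F_n * μ` for the Fejér means of `μ` and
`h ≥ 0` for a continuous test function; integrals without a measure are against `dθ / 2π`.
Orthonormality gives `∫ K_n dμ ≤ n + 1`, so that `K_n / (n + 1)` has `μ_s`-mass at most
`1 - ∫ w K_n / (n + 1)`. The extremal property of `K_n`, tested on the Dirichlet kernel centred at
`ζ`, gives `1 ≤ (F_n * μ)(ζ) K_n(ζ) / (n + 1)`, whence by AM–GM
`2 min (1, w h) ≤ h (F_n * μ) + w K_n / (n + 1)`. Integrating and letting `n → ∞`, the limit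
superior of the `μ_s`-mass is at most `1 + ∫ h dμ - 2 ∫ min (1, w h)`. When `h` approximates in
`L¹(μ)` the function that is `1 / w` where `w > 0` and `0` on a null set carrying `μ_s`, this bound
tends to the measure of `{w = 0}`.
-/

noncomputable section

namespace OPUC

open scoped InnerProductSpace

theorem integrable_of_continuous {X E : Type*} [TopologicalSpace X] [CompactSpace X]
    [MeasurableSpace X] [OpensMeasurableSpace X] [NormedAddCommGroup E]
    [SecondCountableTopologyEither X E] {μ : Measure X} [IsFiniteMeasureOnCompacts μ] {f : X → E}
    (hf : Continuous f) : Integrable f μ :=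
  hf.integrable_of_hasCompactSupport (.of_compactSpace f)

section Circle

theorem integral_circleLebesgue {E : Type*} [NormedAddCommGroup E] [NormedSpace ℝ E] {f : ℂ → E}
    (hf : Continuous fun z : Circle => f z) :
    ∫ z : Circle, f z ∂circleLebesgue = Real.circleAverage f 0 1 := by
  have hper : Function.Periodic (fun θ => f (circleMap 0 1 θ)) (2 * Real.pi) :=
    (periodic_circleMap 0 1).comp f
  rw [circleLebesgue, integral_smul_measure,
    integral_map Circle.exp.continuous.aemeasurable hf.aestronglyMeasurable,
    ← intervalIntegral.integral_of_le (by linarith [Real.pi_pos]), Real.circleAverage,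
    ENNReal.toReal_inv, ENNReal.toReal_ofReal Real.two_pi_pos.le]
  convert congrArg ((2 * Real.pi)⁻¹ • ·) (hper.intervalIntegral_add_eq (-Real.pi) 0) using 3
  · simp [circleMap]
  · ring
  · simp

instance : IsProbabilityMeasure circleLebesgue := by
  constructor
  rw [circleLebesgue, Measure.smul_apply,
    Measure.map_apply Circle.exp.continuous.measurable MeasurableSet.univ, Set.preimage_univ,
    Measure.restrict_apply_univ, Real.volume_Ioc, smul_eq_mul,
    show Real.pi - -Real.pi = 2 * Real.pi by ring]
  exact ENNReal.inv_mul_cancel (by simp [Real.pi_pos]) ENNReal.ofReal_ne_top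

instance : NullSingletonClass circleLebesgue where
  measure_singleton z := by
    have hsub : (Circle.exp ⁻¹' {z} ∩ Set.Ioc (-Real.pi) Real.pi).Subsingleton :=
      fun s hs t ht => Circle.exp_injOn_Ioc (by linarith) hs.2 ht.2 (hs.1.trans ht.1.symm)
    rw [circleLebesgue, Measure.smul_apply,
      Measure.map_apply Circle.exp.continuous.measurable (measurableSet_singleton z),
      Measure.restrict_apply (Circle.exp.continuous.measurable (measurableSet_singleton z)),
      hsub.measure_zero, smul_zero]

theorem integral_norm_eval_sq_circleLebesgue (p : ℂ[X]) :
    ∫ z : Circle, ‖p.eval (z : ℂ)‖ ^ 2 ∂circleLebesgue = ∑ i ∈ p.support, ‖p.coeff i‖ ^ 2 := by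
  rw [p.sum_sq_norm_coeff_eq_circleAverage,
    integral_circleLebesgue (f := fun z => ‖p.eval z‖ ^ 2) (by fun_prop)]

end Circle

section L2

variable (μ : Measure Circle) [IsFiniteMeasure μ]

/-- The class in `L²(∂𝔻, μ)` of the restriction of a polynomial to the unit circle. -/
def toL2 : ℂ[X] →ₗ[ℂ] Circle →₂[μ] ℂ :=
  (ContinuousMap.toLp 2 μ ℂ).toLinearMap ∘ₗ
    (aeval (⟨fun z => z, continuous_subtype_val⟩ : C(Circle, ℂ))).toLinearMap

theorem inner_toL2 (p q : ℂ[X]) : ⟪toL2 μ p, toL2 μ q⟫_ℂ = polyInner μ p q := by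
  refine (ContinuousMap.inner_toLp μ _ _).trans (integral_congr_ae (.of_forall fun z => ?_))
  simp only [AlgHom.toLinearMap_apply, aeval_continuousMap_apply]
  exact mul_comm _ _

theorem norm_toL2_sq (p : ℂ[X]) : ‖toL2 μ p‖ ^ 2 = ∫ z : Circle, ‖p.eval (z : ℂ)‖ ^ 2 ∂μ := by
  rw [norm_sq_eq_re_inner (𝕜 := ℂ), inner_toL2, polyInner]
  simp_rw [Complex.conj_mul']
  norm_cast

theorem norm_toL2 (p : ℂ[X]) : ‖toL2 μ p‖ = polyNorm μ p := by
  rw [polyNorm, ← norm_toL2_sq, Real.sqrt_sq (norm_nonneg _)]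

theorem toL2_monicOPUC (n : ℕ) :
    toL2 μ (monicOPUC μ n) = InnerProductSpace.gramSchmidt ℂ (fun k => toL2 μ (X ^ k)) n := by
  induction n using Nat.strong_induction_on with
  | _ n ih =>
    rw [monicOPUC, InnerProductSpace.gramSchmidt_def, Nat.Iio_eq_range, Finset.sum_range]
    simp only [Submodule.starProjection_singleton, map_sub, map_sum, ← smul_eq_C_mul, map_smul]
    congr 1
    refine Finset.sum_congr rfl fun j _ => ?_
    rw [← ih j j.isLt, ← inner_toL2, ← inner_toL2, inner_self_eq_norm_sq_to_K]
    push_cast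
    rfl

theorem toL2_orthonormalOPUC (n : ℕ) :
    toL2 μ (orthonormalOPUC μ n) =
      InnerProductSpace.gramSchmidtNormed ℂ (fun k => toL2 μ (X ^ k)) n := by
  rw [orthonormalOPUC, ← smul_eq_C_mul, map_smul, ← norm_toL2, toL2_monicOPUC,
    InnerProductSpace.gramSchmidtNormed, Complex.ofReal_inv]
  rfl

theorem norm_toL2_orthonormalOPUC_le_one (n : ℕ) : ‖toL2 μ (orthonormalOPUC μ n)‖ ≤ 1 := by
  by_cases h : toL2 μ (orthonormalOPUC μ n) = 0
  · simp [h]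
  · rw [toL2_orthonormalOPUC] at h ⊢
    exact (InnerProductSpace.gramSchmidtNormed_unit_length' h).le

variable {μ} in
theorem toL2_mem_span_orthonormalOPUC {p : ℂ[X]} {n : ℕ} (hp : p.natDegree ≤ n) :
    toL2 μ p ∈ Submodule.span ℂ
      ((fun k => toL2 μ (orthonormalOPUC μ k)) '' (Finset.range (n + 1) : Set ℕ)) := by
  have hIic : (Finset.range (n + 1) : Set ℕ) = Set.Iic n := by ext; simp
  simp_rw [toL2_orthonormalOPUC, hIic]
  rw [InnerProductSpace.span_gramSchmidtNormed, InnerProductSpace.span_gramSchmidt_Iic,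
    p.as_sum_range' (n + 1) (Nat.lt_succ_of_le hp), map_sum]
  refine Submodule.sum_mem _ fun k hk => ?_
  rw [← smul_X_eq_monomial, map_smul]
  exact Submodule.smul_mem _ _ (Submodule.subset_span
    ⟨k, Nat.lt_succ_iff.1 (Finset.mem_range.1 hk), rfl⟩)

end L2

section Nontrivial

/-- A measure on the unit circle is nontrivial if it is not supported on a finite set; this is
what makes every `Φ_n` nonzero in `L²(∂𝔻, μ)`. -/
def IsNontrivial (μ : Measure Circle) : Prop :=
  ∀ s : Set Circle, s.Finite → μ sᶜ ≠ 0

theorem isNontrivial_of_absolutelyContinuous {μ ν : Measure Circle} [NeZero ν]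
    [NullSingletonClass ν] (h : ν ≪ μ) : IsNontrivial μ := fun s hs hμs =>
  NeZero.ne ν <| Measure.measure_univ_eq_zero.1 <| by
    rw [← Set.union_compl_self s]
    exact measure_union_null (hs.measure_zero ν) (h hμs)

theorem IsNontrivial.of_rnDeriv {μ : Measure Circle}
    (h : ¬ μ.rnDeriv circleLebesgue =ᵐ[circleLebesgue] 0) : IsNontrivial μ := by
  set ν := circleLebesgue.withDensity (μ.rnDeriv circleLebesgue)
  have : NeZero ν := ⟨fun h0 => h <|
    (withDensity_eq_zero_iff (μ.measurable_rnDeriv circleLebesgue).aemeasurable).1 h0⟩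
  have : NullSingletonClass ν :=
    ⟨fun z => withDensity_absolutelyContinuous _ _ (measure_singleton z)⟩
  exact isNontrivial_of_absolutelyContinuous (ν := ν)
    (μ.withDensity_rnDeriv_le circleLebesgue).absolutelyContinuous

variable {μ : Measure Circle} [IsFiniteMeasure μ] (hμ : IsNontrivial μ)
include hμ

theorem IsNontrivial.toL2_injective : Function.Injective (toL2 μ) := by
  refine (injective_iff_map_eq_zero _).2 fun p hp => by_contra fun hp0 => ?_
  have hae : ∀ᵐ z : Circle ∂μ, p.eval (z : ℂ) = 0 := by
    have hint : ∫ z : Circle, ‖p.eval (z : ℂ)‖ ^ 2 ∂μ = 0 := by simp [← norm_toL2_sq, hp]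
    have hcont : Continuous fun z : Circle => ‖p.eval (z : ℂ)‖ ^ 2 := by fun_prop
    rw [integral_eq_zero_iff_of_nonneg (fun _ => by positivity)
      (integrable_of_continuous hcont)] at hint
    filter_upwards [hint] with z hz
    simpa using hz
  exact hμ {z | p.eval (z : ℂ) = 0}
    ((finite_setOfPred_isRoot hp0).preimage Subtype.val_injective.injOn) hae

theorem IsNontrivial.orthonormal_toL2 :
    Orthonormal ℂ fun n => toL2 μ (orthonormalOPUC μ n) := by
  simp_rw [toL2_orthonormalOPUC]
  refine InnerProductSpace.gramSchmidtNormed_orthonormal ?_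
  have hcomp : (fun k => toL2 μ (X ^ k)) = toL2 μ ∘ basisMonomials ℂ := by
    ext1 k
    simp [X_pow_eq_monomial]
  exact hcomp ▸ (basisMonomials ℂ).linearIndependent.map' (toL2 μ)
    (LinearMap.ker_eq_bot.2 hμ.toL2_injective)

end Nontrivial

theorem sum_inner_smul_eq_of_mem_span {𝕜 E ι : Type*} [RCLike 𝕜] [NormedAddCommGroup E]
    [InnerProductSpace 𝕜 E] {v : ι → E} (hv : Orthonormal 𝕜 v) {s : Finset ι} {x : E}
    (hx : x ∈ Submodule.span 𝕜 (v '' s)) : ∑ i ∈ s, ⟪v i, x⟫_𝕜 • v i = x := by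
  obtain ⟨l, hl, rfl⟩ := (Finsupp.mem_span_image_iff_linearCombination 𝕜).1 hx
  simp_rw [hv.inner_right_finsupp]
  exact (Finsupp.linearCombination_apply_of_mem_supported 𝕜 hl).symm

section CDKernel

/-- The diagonal `K_n(ζ, ζ)` of the Christoffel–Darboux kernel of `μ`. -/
def cdKernel (μ : Measure Circle) (n : ℕ) (ζ : Circle) : ℝ :=
  ∑ j ∈ Finset.range (n + 1), ‖(orthonormalOPUC μ j).eval (ζ : ℂ)‖ ^ 2

theorem cdKernel_nonneg (μ : Measure Circle) (n : ℕ) (ζ : Circle) : 0 ≤ cdKernel μ n ζ :=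
  Finset.sum_nonneg fun _ _ => by positivity

theorem continuous_cdKernel (μ : Measure Circle) (n : ℕ) : Continuous (cdKernel μ n) := by
  unfold cdKernel
  fun_prop

theorem integral_cdKernel_le (μ : Measure Circle) [IsFiniteMeasure μ] (n : ℕ) :
    ∫ ζ, cdKernel μ n ζ ∂μ ≤ n + 1 := by
  have hint (j : ℕ) : Integrable (fun ζ : Circle => ‖(orthonormalOPUC μ j).eval (ζ : ℂ)‖ ^ 2) μ :=
    integrable_of_continuous (by fun_prop)
  calc ∫ ζ, cdKernel μ n ζ ∂μ
      = ∑ j ∈ Finset.range (n + 1), ‖toL2 μ (orthonormalOPUC μ j)‖ ^ 2 := by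
        simp_rw [cdKernel, norm_toL2_sq]
        exact integral_finsetSum _ fun j _ => hint j
    _ ≤ ∑ j ∈ Finset.range (n + 1), 1 :=
        Finset.sum_le_sum fun j _ =>
          pow_le_one₀ (norm_nonneg _) (norm_toL2_orthonormalOPUC_le_one μ j)
    _ = n + 1 := by simp

/-- The Christoffel variational principle: `1 / K_n(ζ, ζ)` is the minimum of `∫ |p|² dμ` over
polynomials of degree at most `n` with `p(ζ) = 1`. -/
theorem IsNontrivial.norm_eval_sq_le {μ : Measure Circle} [IsFiniteMeasure μ]
    (hμ : IsNontrivial μ) {p : ℂ[X]} {n : ℕ} (hp : p.natDegree ≤ n) (ζ : Circle) :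
    ‖p.eval (ζ : ℂ)‖ ^ 2 ≤ (∫ z : Circle, ‖p.eval (z : ℂ)‖ ^ 2 ∂μ) * cdKernel μ n ζ := by
  set c : ℕ → ℂ := fun j => ⟪toL2 μ (orthonormalOPUC μ j), toL2 μ p⟫_ℂ
  have hexp : ∑ j ∈ Finset.range (n + 1), c j • orthonormalOPUC μ j = p :=
    hμ.toL2_injective <| by
      simpa using
        sum_inner_smul_eq_of_mem_span hμ.orthonormal_toL2 (toL2_mem_span_orthonormalOPUC hp)
  have heval : p.eval (ζ : ℂ) =
      ∑ j ∈ Finset.range (n + 1), c j * (orthonormalOPUC μ j).eval (ζ : ℂ) := by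
    conv_lhs => rw [← hexp]
    simp [eval_finsetSum]
  calc ‖p.eval (ζ : ℂ)‖ ^ 2
      ≤ (∑ j ∈ Finset.range (n + 1), ‖c j‖ * ‖(orthonormalOPUC μ j).eval (ζ : ℂ)‖) ^ 2 := by
        rw [heval]
        gcongr
        simpa only [norm_mul] using norm_sum_le (Finset.range (n + 1))
          fun j => c j * (orthonormalOPUC μ j).eval (ζ : ℂ)
    _ ≤ (∑ j ∈ Finset.range (n + 1), ‖c j‖ ^ 2) * cdKernel μ n ζ :=
        Finset.sum_mul_sq_le_sq_mul_sq _ _ _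
    _ ≤ ‖toL2 μ p‖ ^ 2 * cdKernel μ n ζ := by
        gcongr
        · exact cdKernel_nonneg μ n ζ
        · exact hμ.orthonormal_toL2.sum_inner_products_le _
    _ = _ := by rw [norm_toL2_sq]

end CDKernel

section Fejer

/-- The Dirichlet kernel centred at `ζ`, as a polynomial: `∑_{j ≤ n} (z / ζ)^j`. -/
def dirichletPoly (n : ℕ) (ζ : Circle) : ℂ[X] :=
  ∑ j ∈ Finset.range (n + 1), monomial j ((ζ⁻¹ ^ j : Circle) : ℂ)

/-- The Fejér kernel `F_n(z / ζ)` of the unit circle. -/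
def fejerKernel (n : ℕ) (z ζ : Circle) : ℝ :=
  ‖∑ j ∈ Finset.range (n + 1), ((z / ζ : Circle) : ℂ) ^ j‖ ^ 2 / (n + 1)

/-- The density with respect to `circleLebesgue` of the `n`-th Fejér mean of `μ`. -/
def fejerMean (μ : Measure Circle) (n : ℕ) (ζ : Circle) : ℝ :=
  ∫ z, fejerKernel n z ζ ∂μ

theorem natDegree_dirichletPoly_le (n : ℕ) (ζ : Circle) : (dirichletPoly n ζ).natDegree ≤ n :=
  natDegree_sum_le_of_forall_le _ _ fun _ hj =>
    (natDegree_monomial_le _).trans (Nat.lt_succ_iff.1 (Finset.mem_range.1 hj))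

theorem eval_dirichletPoly (n : ℕ) (z ζ : Circle) :
    (dirichletPoly n ζ).eval (z : ℂ) = ∑ j ∈ Finset.range (n + 1), ((z / ζ : Circle) : ℂ) ^ j := by
  rw [dirichletPoly, eval_finsetSum]
  refine Finset.sum_congr rfl fun j _ => ?_
  rw [eval_monomial, Circle.coe_pow, ← mul_pow, ← Circle.coe_mul, div_eq_inv_mul]

theorem eval_dirichletPoly_self (n : ℕ) (ζ : Circle) :
    (dirichletPoly n ζ).eval (ζ : ℂ) = n + 1 := by
  simp [eval_dirichletPoly]

theorem norm_eval_dirichletPoly_sq (n : ℕ) (z ζ : Circle) :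
    ‖(dirichletPoly n ζ).eval (z : ℂ)‖ ^ 2 = (n + 1) * fejerKernel n z ζ := by
  rw [eval_dirichletPoly, fejerKernel, mul_div_cancel₀ _ n.cast_add_one_ne_zero]

theorem fejerKernel_nonneg (n : ℕ) (z ζ : Circle) : 0 ≤ fejerKernel n z ζ := by
  unfold fejerKernel
  positivity

theorem fejerKernel_comm (n : ℕ) (z ζ : Circle) : fejerKernel n z ζ = fejerKernel n ζ z := by
  rw [fejerKernel, ← RCLike.norm_conj, map_sum, fejerKernel, ← inv_div z ζ]
  simp only [map_pow, Circle.coe_inv_eq_conj]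

theorem continuous_fejerKernel (n : ℕ) :
    Continuous (Function.uncurry (fejerKernel n)) := by
  have h : Continuous fun u : Circle =>
      ‖∑ j ∈ Finset.range (n + 1), (u : ℂ) ^ j‖ ^ 2 / ((n : ℝ) + 1) := by fun_prop
  exact h.comp continuous_div'

theorem integral_fejerKernel (n : ℕ) (z : Circle) :
    ∫ ζ, fejerKernel n z ζ ∂circleLebesgue = 1 := by
  have hcoeff {i : ℕ} (hi : i ∈ Finset.range (n + 1)) : ‖(dirichletPoly n z).coeff i‖ ^ 2 = 1 := by
    have h : (dirichletPoly n z).coeff i = ((z⁻¹ ^ i : Circle) : ℂ) := by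
      simpa only [dirichletPoly, finsetSum_coeff, coeff_monomial, Finset.sum_ite_eq',
        Finset.mem_range, ite_eq_left_iff] using fun h => absurd (Finset.mem_range.1 hi) h
    rw [h, Circle.norm_coe, one_pow]
  have hsupp : (dirichletPoly n z).support ⊆ Finset.range (n + 1) := fun i hi =>
    Finset.mem_range.2 (Nat.lt_succ_of_le
      ((le_natDegree_of_mem_supp i hi).trans (natDegree_dirichletPoly_le n z)))
  have hn : ((n : ℝ) + 1) ≠ 0 := n.cast_add_one_ne_zero
  refine mul_left_cancel₀ hn ?_
  calc (n + 1) * ∫ ζ, fejerKernel n z ζ ∂circleLebesgue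
      = ∫ ζ : Circle, ‖(dirichletPoly n z).eval (ζ : ℂ)‖ ^ 2 ∂circleLebesgue := by
        simp_rw [norm_eval_dirichletPoly_sq, integral_const_mul, fejerKernel_comm n z]
    _ = ∑ i ∈ Finset.range (n + 1), ‖(dirichletPoly n z).coeff i‖ ^ 2 := by
        rw [integral_norm_eval_sq_circleLebesgue]
        exact Finset.sum_subset hsupp fun i _ hi => by simp [notMem_support_iff.1 hi]
    _ = (n + 1) * 1 := by
        rw [Finset.sum_congr rfl fun i hi => hcoeff hi]
        simp

theorem dist_sq_mul_fejerKernel_le (n : ℕ) (z ζ : Circle) :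
    dist z ζ ^ 2 * fejerKernel n z ζ ≤ 4 / (n + 1) := by
  set u : Circle := z / ζ with hu
  have hdist : dist z ζ = ‖(u : ℂ) - 1‖ := by
    calc dist z ζ = ‖(z : ℂ) - ζ‖ := dist_eq_norm (z : ℂ) ζ
      _ = ‖(u : ℂ) - 1‖ := by
        rw [hu, Circle.coe_div, div_sub_one ζ.coe_ne_zero, norm_div, Circle.norm_coe, div_one]
  have hgeom : ‖∑ j ∈ Finset.range (n + 1), (u : ℂ) ^ j‖ * ‖(u : ℂ) - 1‖ ≤ 2 := by
    rw [← norm_mul, geom_sum_mul]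
    exact (norm_sub_le _ _).trans (by norm_num [Circle.norm_coe])
  rw [hdist, fejerKernel, ← mul_div_assoc, ← mul_pow, mul_comm]
  gcongr
  exact (pow_le_pow_left₀ (by positivity) hgeom 2).trans_eq (by norm_num)

theorem tendstoUniformlyOn_fejerKernel {z : Circle} {u : Set Circle} (hu : IsOpen u)
    (hz : z ∈ u) : TendstoUniformlyOn (fun n => fejerKernel n z) 0 atTop uᶜ := by
  obtain ⟨δ, hδ, hball⟩ := Metric.isOpen_iff.1 hu z hz
  have hlim : Tendsto (fun n : ℕ => 4 / ((n : ℝ) + 1) / δ ^ 2) atTop (𝓝 0) := by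
    simpa [div_eq_mul_inv] using
      (tendsto_one_div_add_atTop_nhds_zero_nat.const_mul (4 : ℝ)).mul_const ((δ ^ 2)⁻¹)
  refine Metric.tendstoUniformlyOn_iff.2 fun ε hε => ?_
  filter_upwards [hlim.eventually_lt_const hε] with n hn ζ hζ
  have hfar : δ ≤ dist z ζ := by
    rw [dist_comm]
    exact not_lt.1 fun h => hζ (hball h)
  rw [Pi.zero_apply, dist_zero_left, Real.norm_of_nonneg (fejerKernel_nonneg n z ζ)]
  refine lt_of_le_of_lt ((le_div_iff₀' (by positivity)).2 ?_) hn
  exact (mul_le_mul_of_nonneg_right (by gcongr) (fejerKernel_nonneg n z ζ)).trans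
    (dist_sq_mul_fejerKernel_le n z ζ)

theorem tendsto_integral_fejerKernel_mul {h : Circle → ℝ} (hh : Continuous h) (z : Circle) :
    Tendsto (fun n => ∫ ζ, fejerKernel n z ζ * h ζ ∂circleLebesgue) atTop (𝓝 (h z)) := by
  refine tendsto_integral_peak_smul_of_integrable_of_tendsto (φ := fun n => fejerKernel n z)
    MeasurableSet.univ univ_mem (measure_ne_top _ _)
    (.of_forall fun n => fejerKernel_nonneg n z)
    (fun u hu hz => tendstoUniformlyOn_fejerKernel hu hz) ?_ (.of_forall fun n => ?_)
    (integrable_of_continuous hh) hh.continuousAt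
  · simp [integral_fejerKernel]
  · exact ((continuous_fejerKernel n).uncurry_left z).aestronglyMeasurable

section FejerMean

theorem fejerMean_nonneg (μ : Measure Circle) (n : ℕ) (ζ : Circle) : 0 ≤ fejerMean μ n ζ :=
  integral_nonneg fun z => fejerKernel_nonneg n z ζ

variable (μ : Measure Circle) [IsFiniteMeasure μ] {h : Circle → ℝ} (hh : Continuous h) (n : ℕ)

include hh

theorem continuous_fejerKernel_mul :
    Continuous fun p : Circle × Circle => fejerKernel n p.1 p.2 * h p.2 :=
  (continuous_fejerKernel n).mul (hh.comp continuous_snd)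

theorem integrable_mul_fejerMean : Integrable (fun ζ => h ζ * fejerMean μ n ζ) circleLebesgue := by
  have hint := (integrable_of_continuous (μ := μ.prod circleLebesgue)
    (continuous_fejerKernel_mul hh n)).integral_prod_right
  simp_rw [integral_mul_const] at hint
  simpa only [fejerMean, mul_comm] using hint

theorem integral_mul_fejerMean :
    ∫ ζ, h ζ * fejerMean μ n ζ ∂circleLebesgue =
      ∫ z, ∫ ζ, fejerKernel n z ζ * h ζ ∂circleLebesgue ∂μ := by
  rw [integral_integral_swap (integrable_of_continuous (continuous_fejerKernel_mul hh n))]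
  simp_rw [integral_mul_const, mul_comm, fejerMean]

theorem tendsto_integral_mul_fejerMean :
    Tendsto (fun n => ∫ ζ, h ζ * fejerMean μ n ζ ∂circleLebesgue) atTop (𝓝 (∫ z, h z ∂μ)) := by
  obtain ⟨M, hM⟩ := isCompact_univ.exists_bound_of_continuousOn hh.continuousOn
  simp_rw [integral_mul_fejerMean μ hh]
  refine tendsto_integral_of_dominated_convergence (fun _ => M) (fun n => ?_) (integrable_const M)
    (fun n => .of_forall fun z => ?_) (.of_forall fun z => tendsto_integral_fejerKernel_mul hh z)
  · exact (continuous_fejerKernel_mul hh n).aestronglyMeasurable.integral_prod_right'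
  · have hker : Continuous (fejerKernel n z) := (continuous_fejerKernel n).uncurry_left z
    calc ‖∫ ζ, fejerKernel n z ζ * h ζ ∂circleLebesgue‖
        ≤ ∫ ζ, fejerKernel n z ζ * M ∂circleLebesgue := by
          refine norm_integral_le_of_norm_le (integrable_of_continuous (hker.mul continuous_const))
            (.of_forall fun ζ => ?_)
          rw [norm_mul, Real.norm_of_nonneg (fejerKernel_nonneg n z ζ)]
          exact mul_le_mul_of_nonneg_left (hM ζ trivial) (fejerKernel_nonneg n z ζ)
      _ = M := by rw [integral_mul_const, integral_fejerKernel, one_mul]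

end FejerMean

end Fejer

section LebesgueDecomposition

variable {α E : Type*} [MeasurableSpace α] [NormedAddCommGroup E] [NormedSpace ℝ E]
  {μ ν : Measure α} [SigmaFinite μ] [μ.HaveLebesgueDecomposition ν]

theorem integrable_iff_singularPart_and_rnDeriv_smul {f : α → E} :
    Integrable f μ ↔ Integrable f (μ.singularPart ν) ∧
      Integrable (fun x => (μ.rnDeriv ν x).toReal • f x) ν := by
  conv_lhs => rw [μ.haveLebesgueDecomposition_add ν]
  rw [integrable_add_measure, integrable_withDensity_iff_integrable_smul'
    (μ.measurable_rnDeriv ν) (μ.rnDeriv_lt_top ν)]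

theorem integral_eq_singularPart_add_rnDeriv_smul {f : α → E} (hf : Integrable f μ) :
    ∫ x, f x ∂μ = ∫ x, f x ∂μ.singularPart ν + ∫ x, (μ.rnDeriv ν x).toReal • f x ∂ν := by
  have hf' : Integrable f (μ.singularPart ν + ν.withDensity (μ.rnDeriv ν)) := by
    rwa [← μ.haveLebesgueDecomposition_add ν]
  conv_lhs => rw [μ.haveLebesgueDecomposition_add ν]
  rw [integral_add_measure hf'.left_of_add_measure hf'.right_of_add_measure,
    integral_withDensity_eq_integral_toReal_smul (μ.measurable_rnDeriv ν) (μ.rnDeriv_lt_top ν)]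

end LebesgueDecomposition

section UpperFunctional

/-- The functional `∫ h dμ - 2 ∫ min (1, w h) dν`, where `w` is the density of the part of `μ`
absolutely continuous with respect to `ν`. Up to an additive constant it bounds the limit superior
of the normalized singular mass for every continuous `h ≥ 0`. -/
def upperFunctional {α : Type*} [MeasurableSpace α] (μ ν : Measure α) (h : α → ℝ) : ℝ :=
  ∫ x, h x ∂μ - 2 * ∫ x, min 1 ((μ.rnDeriv ν x).toReal * h x) ∂ν

variable {α : Type*} [MeasurableSpace α] {μ ν : Measure α} [SigmaFinite μ] [IsFiniteMeasure ν]

theorem integrable_min_one_rnDeriv_mul {h : α → ℝ} (hh : Integrable h μ) :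
    Integrable (fun x => min 1 ((μ.rnDeriv ν x).toReal * h x)) ν :=
  (integrable_const 1).inf (integrable_iff_singularPart_and_rnDeriv_smul.1 hh).2

theorem upperFunctional_le_add {f g : α → ℝ} (hf : Integrable f μ) (hg : Integrable g μ) :
    upperFunctional μ ν g ≤ upperFunctional μ ν f + 3 * ∫ x, |f x - g x| ∂μ := by
  set w := fun x => (μ.rnDeriv ν x).toReal
  have hfg : Integrable (fun x => |f x - g x|) μ := (hf.sub hg).abs
  have hwfg : Integrable (fun x => w x * |f x - g x|) ν :=
    (integrable_iff_singularPart_and_rnDeriv_smul.1 hfg).2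
  have hfirst : ∫ x, g x ∂μ - ∫ x, f x ∂μ ≤ ∫ x, |f x - g x| ∂μ := by
    rw [← integral_sub hg hf]
    refine integral_mono (hg.sub hf) hfg fun x => ?_
    rw [abs_sub_comm]
    exact le_abs_self _
  have hpoint (x : α) : min 1 (w x * f x) - min 1 (w x * g x) ≤ w x * |f x - g x| := by
    have hlip := abs_min_sub_min_le_max 1 (w x * f x) 1 (w x * g x)
    rw [sub_self, abs_zero, max_eq_right (abs_nonneg _), ← mul_sub, abs_mul,
      abs_of_nonneg ENNReal.toReal_nonneg] at hlip
    exact (le_abs_self _).trans hlip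
  have hsecond : ∫ x, min 1 (w x * f x) ∂ν - ∫ x, min 1 (w x * g x) ∂ν ≤
      ∫ x, |f x - g x| ∂μ := calc
    _ = ∫ x, (min 1 (w x * f x) - min 1 (w x * g x)) ∂ν :=
      (integral_sub (integrable_min_one_rnDeriv_mul hf) (integrable_min_one_rnDeriv_mul hg)).symm
    _ ≤ ∫ x, w x * |f x - g x| ∂ν :=
      integral_mono ((integrable_min_one_rnDeriv_mul hf).sub (integrable_min_one_rnDeriv_mul hg))
        hwfg hpoint
    _ ≤ ∫ x, |f x - g x| ∂μ := by
      rw [integral_eq_singularPart_add_rnDeriv_smul (ν := ν) hfg]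
      exact le_add_of_nonneg_left (integral_nonneg fun _ => abs_nonneg _)
  unfold upperFunctional
  linarith

theorem exists_integrable_upperFunctional_eq (μ ν : Measure α) [SigmaFinite μ]
    [IsFiniteMeasure ν] : ∃ f : α → ℝ, 0 ≤ f ∧ Integrable f μ ∧
      upperFunctional μ ν f = -ν.real {x | μ.rnDeriv ν x ≠ 0} := by
  set w := μ.rnDeriv ν
  have hsing := μ.mutuallySingular_singularPart ν
  have hmeas : MeasurableSet {x | w x ≠ 0} :=
    (μ.measurable_rnDeriv ν) (measurableSet_singleton 0).compl
  -- Wherever `w > 0`, the choice `h = 1 / w` maximizes `2 * min 1 (w * h) - w * h`.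
  set f : α → ℝ := hsing.nullSet.indicator fun x => (w x).toReal⁻¹ with hf
  have hwf : (fun x => (w x).toReal * f x) =ᵐ[ν] {x | w x ≠ 0}.indicator 1 := by
    filter_upwards [μ.rnDeriv_lt_top ν, measure_eq_zero_iff_ae_notMem.1
      hsing.measure_compl_nullSet] with x hx hmem
    rw [hf, Set.indicator_of_mem (not_not.1 hmem)]
    by_cases h0 : w x = 0
    · simp [h0]
    · simpa [h0] using mul_inv_cancel₀ (ENNReal.toReal_ne_zero.2 ⟨h0, hx.ne⟩)
  have hfs : f =ᵐ[μ.singularPart ν] 0 := by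
    filter_upwards [measure_eq_zero_iff_ae_notMem.1 hsing.measure_nullSet] with x hx
    exact Set.indicator_of_notMem hx _
  have hint : Integrable f μ := integrable_iff_singularPart_and_rnDeriv_smul.2
    ⟨(integrable_zero _ _ _).congr hfs.symm,
      ((integrable_const 1).indicator hmeas).congr hwf.symm⟩
  refine ⟨f, Set.indicator_nonneg fun x _ => by positivity, hint, ?_⟩
  have hfirst : ∫ x, f x ∂μ = ν.real {x | w x ≠ 0} := by
    rw [integral_eq_singularPart_add_rnDeriv_smul (ν := ν) hint, integral_congr_ae hfs]
    simp_rw [smul_eq_mul]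
    rw [integral_congr_ae hwf, integral_indicator_one hmeas]
    simp
  have hsecond : ∫ x, min 1 ((w x).toReal * f x) ∂ν = ν.real {x | w x ≠ 0} := by
    rw [← integral_indicator_one hmeas]
    refine integral_congr_ae (hwf.mono fun x hx => ?_)
    simp only [hx]
    exact min_eq_right (Set.indicator_le_self' (fun _ _ => zero_le_one) x)
  rw [upperFunctional, hfirst, hsecond]
  ring

theorem exists_continuous_upperFunctional_lt [TopologicalSpace α] [NormalSpace α] [BorelSpace α]
    [μ.WeaklyRegular] {c : ℝ} (hc : -ν.real {x | μ.rnDeriv ν x ≠ 0} < c) :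
    ∃ g : α → ℝ, Continuous g ∧ 0 ≤ g ∧ upperFunctional μ ν g < c := by
  obtain ⟨f, hf0, hf, hfeq⟩ := exists_integrable_upperFunctional_eq μ ν
  set ε := (c + ν.real {x | μ.rnDeriv ν x ≠ 0}) / 6 with hε
  obtain ⟨g, hfg, hg⟩ := hf.exists_boundedContinuous_integral_sub_le (show 0 < ε by linarith)
  have hgmax : Integrable (fun x => max (g x) 0) μ := hg.pos_part
  refine ⟨fun x => max (g x) 0, by fun_prop, fun x => le_max_right _ _, ?_⟩
  have hdist : ∫ x, |f x - max (g x) 0| ∂μ ≤ ε := by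
    refine (integral_mono (hf.sub hgmax).abs (hf.sub hg).norm fun x => ?_).trans hfg
    have hclip := abs_max_sub_max_le_abs (f x) (g x) 0
    rwa [max_eq_left (show 0 ≤ f x from hf0 x)] at hclip
  linarith [upperFunctional_le_add (ν := ν) hf hgmax]

end UpperFunctional

theorem two_mul_min_one_le {w h b k : ℝ} (hw : 0 ≤ w) (hh : 0 ≤ h) (hb : 0 ≤ b) (hk : 0 ≤ k)
    (hbk : 1 ≤ b * k) : 2 * min 1 (w * h) ≤ h * b + w * k := by
  have hwh : 0 ≤ w * h := mul_nonneg hw hh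
  have : 0 ≤ min 1 (w * h) := le_min zero_le_one hwh
  refine (sq_le_sq₀ (by positivity) (by positivity)).1 ?_
  calc (2 * min 1 (w * h)) ^ 2 = 4 * (min 1 (w * h) * min 1 (w * h)) := by ring
    _ ≤ 4 * (1 * (w * h)) := by gcongr; exacts [min_le_left _ _, min_le_right _ _]
    _ = 4 * (w * h) := by ring
    _ ≤ 4 * (w * h) * (b * k) := le_mul_of_one_le_right (by positivity) hbk
    _ = 4 * (h * b) * (w * k) := by ring
    _ ≤ (h * b + w * k) ^ 2 := four_mul_le_sq_add _ _

section KeyInequality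

variable {μ : Measure Circle} [IsFiniteMeasure μ]

theorem IsNontrivial.one_le_fejerMean_mul (hμ : IsNontrivial μ) (n : ℕ) (ζ : Circle) :
    1 ≤ fejerMean μ n ζ * (cdKernel μ n ζ / (n + 1)) := by
  have hn : (0 : ℝ) < n + 1 := n.cast_add_one_pos
  have hpoint : ‖(dirichletPoly n ζ).eval (ζ : ℂ)‖ = n + 1 := by
    rw [eval_dirichletPoly_self]
    exact_mod_cast Complex.norm_natCast (n + 1)
  have hmean : ∫ z : Circle, ‖(dirichletPoly n ζ).eval (z : ℂ)‖ ^ 2 ∂μ =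
      (n + 1) * fejerMean μ n ζ := by
    simp_rw [norm_eval_dirichletPoly_sq, integral_const_mul, fejerMean]
  have hext := hμ.norm_eval_sq_le (natDegree_dirichletPoly_le n ζ) ζ
  rw [hpoint, hmean, sq, mul_assoc] at hext
  rw [← mul_div_assoc, one_le_div hn]
  exact le_of_mul_le_mul_left hext hn

theorem ae_two_mul_min_one_le (n : ℕ) {h : Circle → ℝ} (h0 : 0 ≤ h) :
    ∀ᵐ ζ ∂circleLebesgue, 2 * min 1 ((μ.rnDeriv circleLebesgue ζ).toReal * h ζ) ≤
      h ζ * fejerMean μ n ζ +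
        (μ.rnDeriv circleLebesgue ζ).toReal * (cdKernel μ n ζ / (n + 1)) := by
  by_cases hw : μ.rnDeriv circleLebesgue =ᵐ[circleLebesgue] 0
  · filter_upwards [hw] with ζ hζ
    simpa [hζ] using mul_nonneg (h0 ζ) (fejerMean_nonneg μ n ζ)
  · exact .of_forall fun ζ => two_mul_min_one_le ENNReal.toReal_nonneg (h0 ζ)
      (fejerMean_nonneg μ n ζ) (div_nonneg (cdKernel_nonneg μ n ζ) n.cast_add_one_pos.le)
      ((IsNontrivial.of_rnDeriv hw).one_le_fejerMean_mul n ζ)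

theorem integral_cdKernel_singularPart_add_le (n : ℕ) {h : Circle → ℝ} (hh : Continuous h)
    (h0 : 0 ≤ h) :
    1 / ((n : ℝ) + 1) * ∫ ζ, cdKernel μ n ζ ∂μ.singularPart circleLebesgue +
        2 * ∫ ζ, min 1 ((μ.rnDeriv circleLebesgue ζ).toReal * h ζ) ∂circleLebesgue ≤
      1 + ∫ ζ, h ζ * fejerMean μ n ζ ∂circleLebesgue := by
  set w := fun ζ => (μ.rnDeriv circleLebesgue ζ).toReal
  set K := fun ζ => cdKernel μ n ζ / ((n : ℝ) + 1)
  have hK : Integrable K μ := integrable_of_continuous ((continuous_cdKernel μ n).div_const _)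
  have hwK : Integrable (fun ζ => w ζ * K ζ) circleLebesgue :=
    (integrable_iff_singularPart_and_rnDeriv_smul.1 hK).2
  have hhF : Integrable (fun ζ => h ζ * fejerMean μ n ζ) circleLebesgue :=
    integrable_mul_fejerMean μ hh n
  have hmass : ∫ ζ, K ζ ∂μ.singularPart circleLebesgue + ∫ ζ, w ζ * K ζ ∂circleLebesgue ≤ 1 := by
    have hdecomp := integral_eq_singularPart_add_rnDeriv_smul (ν := circleLebesgue) hK
    simp only [smul_eq_mul] at hdecomp
    rw [← hdecomp, integral_div]
    exact (div_le_one n.cast_add_one_pos).2 (integral_cdKernel_le μ n)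
  have hpoint : 2 * ∫ ζ, min 1 (w ζ * h ζ) ∂circleLebesgue ≤
      ∫ ζ, h ζ * fejerMean μ n ζ ∂circleLebesgue + ∫ ζ, w ζ * K ζ ∂circleLebesgue := by
    rw [← integral_const_mul, ← integral_add hhF hwK]
    exact integral_mono_ae
      ((integrable_min_one_rnDeriv_mul (integrable_of_continuous hh)).const_mul 2)
      (hhF.add hwK) (ae_two_mul_min_one_le n h0)
  rw [one_div_mul_eq_div, ← integral_div]
  linarith

end KeyInequality

end OPUC

end

open OPUC in
theorem theorem3p3_general (μ : Measure Circle) [IsFiniteMeasure μ] {c : ℝ}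
    (hc : circleLebesgue.real {z | μ.rnDeriv circleLebesgue z = 0} < c) :
    ∀ᶠ n : ℕ in atTop, 1 / ((n : ℝ) + 1) *
      ∫ z : Circle, ∑ j ∈ Finset.range (n + 1),
        ‖(orthonormalOPUC μ j).eval (z : ℂ)‖ ^ 2 ∂(μ.singularPart circleLebesgue) < c := by
  have hcompl : circleLebesgue.real {z | μ.rnDeriv circleLebesgue z = 0} +
      circleLebesgue.real {z | μ.rnDeriv circleLebesgue z ≠ 0} = 1 :=
    probReal_add_probReal_compl (μ.measurable_rnDeriv _ (measurableSet_singleton 0))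
  obtain ⟨h, hh, h0, hlt⟩ := exists_continuous_upperFunctional_lt (μ := μ) (ν := circleLebesgue)
    (show _ < c - 1 by linarith)
  have hlim := (tendsto_integral_mul_fejerMean μ hh).eventually_lt_const
    (show _ < c - 1 + 2 * ∫ ζ, min 1 ((μ.rnDeriv circleLebesgue ζ).toReal * h ζ) ∂circleLebesgue
      from sub_lt_iff_lt_add.1 hlt)
  filter_upwards [hlim] with n hn
  have hbound := integral_cdKernel_singularPart_add_le (μ := μ) n hh h0
  simp only [cdKernel] at hbound
  linarith

theorem theorem3p3 (μ : Measure Circle) [IsFiniteMeasure μ]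
    (hw : ∀ᵐ z ∂OPUC.circleLebesgue, 0 < μ.rnDeriv OPUC.circleLebesgue z) :
    Tendsto (fun n : ℕ => 1 / ((n : ℝ) + 1) *
        ∫ z : Circle, ∑ j ∈ Finset.range (n + 1),
          ‖(OPUC.orthonormalOPUC μ j).eval (z : ℂ)‖ ^ 2 ∂(μ.singularPart OPUC.circleLebesgue))
      atTop (𝓝 0) := by
  have hnull : OPUC.circleLebesgue.real {z | μ.rnDeriv OPUC.circleLebesgue z = 0} = 0 := by
    simpa [measureReal_eq_zero_iff, ae_iff] using hw
  exact tendsto_order.2 ⟨fun a ha => .of_forall fun n => ha.trans_le (by positivity),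
    fun c hc => theorem3p3_general μ (hnull.trans_lt hc)⟩
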